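/- \textbf{The string language.} Fix the following 53 characters: the lower case letters $\mathtt{a},\dots,\mathtt{z}$, the digits $\mathtt 0,\dots,\mathtt 9$, and the 17 characters $\mathtt{"}$, $\backslash$, $=$, $\neq$, $($, $)$, $\sim$, $\&$, $|$, $-$, $>$, $\mathtt A$, $\mathtt E$, $:$, $+$, $*$, $<$. A \emph{string} is a finite sequence of characters. A \emph{string literal} is $\mathtt{"}\beta\mathtt{"}$, where $\beta$ is obtained from some string $\alpha$ by writing $\backslash\mathtt 0$ for each $\backslash$ and $\backslash\mathtt 1$ for each $\mathtt{"}$; it denotes $\alpha$. A \emph{variable} is a lower case letter followed by zero or more digits; its value is a string. A \emph{term} is a non-empty finite sequence of variables and/or string literals; it denotes the concatenation of their values. The \emph{formulae} are the strings $t{=}u$ and $t{\neq}u$ with $t,u$ terms, and $(\pi)$, ${\sim}\pi$, $\pi\&\rho$, $\pi|\rho$, $\pi\mathord{-}\mathord{>}\rho$, $\mathtt Ax{:}\pi$, $\mathtt Ex{:}\pi$ with $\pi,\rho$ formulae and $x$ a variable. Without parentheses they are read with concatenation binding tightest, then $=$ and $\neq$, ${\sim}$, $\&$, $|$, $\mathord{-}\mathord{>}$,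 and finally $:$ (so that the scope of a quantifier reaches as far to the right as possible), and all operators associate to the left. They have the usual meaning, the quantifiers $\mathtt A$ (for all) and $\mathtt E$ (there is) ranging over all strings. A \emph{sentence} is a formula without free variables; it is either true or false. \textbf{Machines.} A \emph{Turing machine} has states $0,\dots,r$ for some $r\ge 1$, a two-way infinite tape whose cells contain one of the 53 characters or a blank, and exactly one rule $(c,q)\mapsto(c',q',d)$ for each tape symbol $c$ and each state $q\ne 0$ (write $c'$, move by $d\in\{\mathtt L,\mathtt R,\mathtt N\}$, enter state $q'$). It starts in state $1$ on the first character of the input string, on an otherwise blank tape, and it halts when it enters state $0$. A \emph{recursively enumerable proof system} is a Turing machine that halts on no string that is not a sentence; it \emph{proves} a sentence if and only if it halts on it. A set of strings is \emph{recursively enumerable} if it is the set of inputs on which some Turing machine halts. \textbf{Theorem 1.} Each recursively enumerable proof system for this first-order language on finite character strings either proves a false sentence or fails to prove a true sentence. Equivalently, the set of true sentences of this language is not recursively enumerable. -/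

import Mathlib

namespace StringTheory

/-- The 53 characters of the language: 26 lower case letters, 10 digits and 17 further characters.
`ne` is the single character written as an overstruck equality sign. -/
inductive Ch where
  | letter (i : Fin 26)
  | digit (i : Fin 10)
  | quote | backslash | eq | ne | lpar | rpar | tilde | amp | bar
  | minus | gt | bigA | bigE | colon | plus | star | lt
  deriving DecidableEq

/-- Finite character strings. -/
abbrev Str : Type := List Ch

/-! ### Syntax -/

/-- The encoded character that denotes a given character: `\0` denotes the backslash, `\1` denotes
the quotation mark, every other character denotes itself. -/
def encodeChar : Ch → Str
  | Ch.backslash => [Ch.backslash, Ch.digit 0]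
  | Ch.quote => [Ch.backslash, Ch.digit 1]
  | c => [c]

/-- The sequence of encoded characters that denotes a given string. -/
def encode (s : Str) : Str := s.flatMap encodeChar

/-- A variable: a lower case letter followed by zero or more digits. -/
structure Var where
  letter : Fin 26
  digits : List (Fin 10)
  deriving DecidableEq

/-- The variable as a string of the language. -/
def Var.render (x : Var) : Str := Ch.letter x.letter :: x.digits.map Ch.digit

/-- A variable or a string literal; a literal is given by the string that it denotes. -/
inductive Item where
  | var (x : Var)
  | lit (s : Str)

/-- The item as a string of the language. -/
def Item.render : Item → Str
  | Item.var x => x.render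
  | Item.lit s => Ch.quote :: encode s ++ [Ch.quote]

/-- A term: a non-empty finite sequence of variables and/or string literals. -/
structure Term where
  items : List Item
  nonempty : items ≠ []

/-- The term as a string of the language. -/
def Term.render (t : Term) : Str := t.items.flatMap Item.render

/-- Syntax trees of formulae. Parentheses are kept in the tree. -/
inductive Formula where
  | eq (t u : Term)
  | ne (t u : Term)
  | paren (p : Formula)
  | neg (p : Formula)
  | and (p q : Formula)
  | or (p q : Formula)
  | imp (p q : Formula)
  | all (x : Var) (p : Formula)
  | ex (x : Var) (p : Formula)

namespace Formula

/-- The formula as a string of the language. -/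
def render : Formula → Str
  | eq t u => t.render ++ [Ch.eq] ++ u.render
  | ne t u => t.render ++ [Ch.ne] ++ u.render
  | paren p => [Ch.lpar] ++ p.render ++ [Ch.rpar]
  | neg p => [Ch.tilde] ++ p.render
  | and p q => p.render ++ [Ch.amp] ++ q.render
  | or p q => p.render ++ [Ch.bar] ++ q.render
  | imp p q => p.render ++ [Ch.minus, Ch.gt] ++ q.render
  | all x p => [Ch.bigA] ++ x.render ++ [Ch.colon] ++ p.render
  | ex x p => [Ch.bigE] ++ x.render ++ [Ch.colon] ++ p.render

/-- Precedence of the outermost operator; a larger number binds tighter. -/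
def prec : Formula → ℕ
  | eq _ _ => 5
  | ne _ _ => 5
  | paren _ => 5
  | neg _ => 4
  | and _ _ => 3
  | or _ _ => 2
  | imp _ _ => 1
  | all _ _ => 0
  | ex _ _ => 0

/-- `p.Open`: the string of `p` ends with the scope of a quantifier that is not enclosed in
parentheses. Since the colon has the lowest precedence, anything that follows (up to the next
unmatched closing parenthesis) would belong to that scope. -/
def Open : Formula → Prop
  | eq _ _ => False
  | ne _ _ => False
  | paren _ => False
  | neg p => p.Open
  | and _ q => q.Open
  | or _ q => q.Open
  | imp _ q => q.Open
  | all _ _ => True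
  | ex _ _ => True

/-- `p` may be the unparenthesised left operand of a left associative operator of precedence `k`. -/
def LeftOperand (k : ℕ) (p : Formula) : Prop := k ≤ p.prec ∧ ¬ p.Open

/-- `p` may be the unparenthesised operand to the right of an operator of precedence `k`, where the
operand must have precedence at least `m`. A quantified formula is always possible there: its
beginning is marked by its quantifier, and its scope reaches as far to the right as possible. -/
def RightOperand (m : ℕ) (p : Formula) : Prop := m ≤ p.prec ∨ p.prec = 0

/-- The tree obeys the precedences (equality, then negation, conjunction, disjunction, implication,
and the colon of quantifiers, from tightest to loosest) and the left associativity of operators. -/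
def WellParsed : Formula → Prop
  | eq _ _ => True
  | ne _ _ => True
  | paren p => p.WellParsed
  | neg p => p.WellParsed ∧ p.RightOperand 4
  | and p q => p.WellParsed ∧ q.WellParsed ∧ p.LeftOperand 3 ∧ q.RightOperand 4
  | or p q => p.WellParsed ∧ q.WellParsed ∧ p.LeftOperand 2 ∧ q.RightOperand 3
  | imp p q => p.WellParsed ∧ q.WellParsed ∧ p.LeftOperand 1 ∧ q.RightOperand 2
  | all _ p => p.WellParsed
  | ex _ p => p.WellParsed

end Formula

/-- The string `s` is a formula of the language, to be read as the syntax tree `p`. -/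
def ReadsAs (s : Str) (p : Formula) : Prop := p.WellParsed ∧ p.render = s

/-! ### Semantics -/

/-- An assignment: each variable contains a string. -/
abbrev Assignment : Type := Var → Str

/-- The string denoted by an item. -/
def Item.value (v : Assignment) : Item → Str
  | Item.var x => v x
  | Item.lit s => s

/-- The string denoted by a term. -/
def Term.value (v : Assignment) (t : Term) : Str := t.items.flatMap (Item.value v)

namespace Formula

/-- The claim expressed by a formula under an assignment. -/
def Holds : Formula → Assignment → Prop
  | eq t u, v => t.value v = u.value v
  | ne t u, v => t.value v ≠ u.value v
  | paren p, v => p.Holds v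
  | neg p, v => ¬ p.Holds v
  | and p q, v => p.Holds v ∧ q.Holds v
  | or p q, v => p.Holds v ∨ q.Holds v
  | imp p q, v => p.Holds v → q.Holds v
  | all x p, v => ∀ s : Str, p.Holds (Function.update v x s)
  | ex x p, v => ∃ s : Str, p.Holds (Function.update v x s)

end Formula

/-- The variables that occur in a term. -/
def Term.vars (t : Term) : Set Var := {x | Item.var x ∈ t.items}

/-- The free variables of a formula. -/
def Formula.freeVars : Formula → Set Var
  | Formula.eq t u => t.vars ∪ u.vars
  | Formula.ne t u => t.vars ∪ u.vars
  | Formula.paren p => p.freeVars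
  | Formula.neg p => p.freeVars
  | Formula.and p q => p.freeVars ∪ q.freeVars
  | Formula.or p q => p.freeVars ∪ q.freeVars
  | Formula.imp p q => p.freeVars ∪ q.freeVars
  | Formula.all x p => p.freeVars \ {x}
  | Formula.ex x p => p.freeVars \ {x}

/-- The string is a sentence: a formula without free variables. -/
def IsSentence (s : Str) : Prop := ∃ p, ReadsAs s p ∧ p.freeVars = ∅

/-- The string is a true sentence. -/
def IsTrueSentence (s : Str) : Prop :=
  ∃ p, ReadsAs s p ∧ p.freeVars = ∅ ∧ ∀ v, p.Holds v

/-- The string is a false sentence. -/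
def IsFalseSentence (s : Str) : Prop :=
  ∃ p, ReadsAs s p ∧ p.freeVars = ∅ ∧ ∀ v, ¬ p.Holds v

/-! ### Turing machines -/

/-- Tape symbols: the 53 characters and the blank `none`. -/
abbrev Symbol : Type := Option Ch

/-- Head movements: left, right, none. -/
inductive Move where
  | L | R | N

/-- The effect of a head movement on a two-way infinite tape. -/
def Move.apply : Move → Turing.Tape Symbol → Turing.Tape Symbol
  | Move.L, T => T.move Turing.Dir.left
  | Move.R, T => T.move Turing.Dir.right
  | Move.N, T => T

/-- A Turing machine with states `0, …, r`, where `0` is the final state, and with exactly one rule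
for each tape symbol and each state other than `0`. -/
structure TuringMachine where
  r : ℕ
  r_pos : 0 < r
  rule : Symbol → (q : Fin (r + 1)) → q ≠ 0 → Symbol × Fin (r + 1) × Move

namespace TuringMachine

/-- A configuration: the state of the control unit, and the tape together with the position of the
read/write head. -/
structure Config (M : TuringMachine) where
  state : Fin (M.r + 1)
  tape : Turing.Tape Symbol

/-- Initially the tape holds the input and is blank elsewhere, the head is on the first character of
the input and the state is `1`. -/
def init (M : TuringMachine) (s : Str) : M.Config where
  state := ⟨1, Nat.succ_lt_succ M.r_pos⟩
  tape := Turing.Tape.mk₁ (s.map some)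

/-- One computation step: write, move, change the state. There is none from the final state. -/
def step (M : TuringMachine) (c : M.Config) : Option M.Config :=
  if h : c.state = 0 then none
  else
    let a := M.rule c.tape.head c.state h
    some ⟨a.2.1, a.2.2.apply (c.tape.write a.1)⟩

/-- The machine eventually halts on input `s`, that is, it reaches the final state. -/
def Halts (M : TuringMachine) (s : Str) : Prop :=
  ∃ c : M.Config, Relation.ReflTransGen (fun a b => M.step a = some b) (M.init s) c ∧ c.state = 0

end TuringMachine

/-- A recursively enumerable proof system: a Turing machine that does not halt on any string that
is not a sentence. -/
structure ProofSystem where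
  machine : TuringMachine
  not_halts : ∀ s : Str, ¬ IsSentence s → ¬ machine.Halts s

/-- A sentence is proven if and only if the machine halts on it. -/
def ProofSystem.Proves (P : ProofSystem) (s : Str) : Prop := IsSentence s ∧ P.machine.Halts s

/-- A set of strings is recursively enumerable: it is the set of inputs on which some Turing machine
halts. -/
def RecursivelyEnumerable (S : Set Str) : Prop :=
  ∃ M : TuringMachine, ∀ s : Str, M.Halts s ↔ s ∈ S

end StringTheory

namespace StringTheory

/-! ### Unique readability -/

/-! The argument is diagonal. For each machine `M`, `exists_diagonal` supplies a closed formula `g`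
that is true exactly when `M` does not halt on the string of `g`. Suppose `M` halts exactly on the
true sentences. Halting on `g` would make `g` true, as its string has no other reading, and so
exclude halting; hence `M` does not halt on `g`, hence `g` is true, hence `M` halts on it: a
contradiction. The machine of a sound and complete proof system would be such an `M`, since it halts
on sentences only and each sentence is true or false.

Halting is expressible by concatenation alone (`Schema.holds_halts`). Finitely many productions,
acting at the ends of the blocks of a configuration code, simulate the machine
(`halts_iff_rewrites`). A whole run is one string in which the codes are separated by a delimiter;
the delimiter is quantified too, so it can be chosen long enough for the run at hand
(`exists_codesRun_iff`).

Self-reference needs no substitution function. The string of `bind x s p` contains `s` as a literal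
and then the text of `p`. If `s` is the text of `p` and has neither quotation marks nor backslashes,
both places show the same string (`encode_render`). Therefore a `Schema` becomes a formula without
literals: its character constants are variables, which receive their values in a prefix (`close`)
whose text does not depend on `p`.

Unique reading is proved only for the fully parenthesised shapes that occur in `g`. -/

theorem encodeChar_append_inj {c c' : Ch} {m m' : Str}
    (h : encodeChar c ++ m = encodeChar c' ++ m') : c = c' ∧ m = m' := by
  cases c <;> cases c' <;> simp_all [encodeChar]

theorem encodeChar_append_ne_quote (c : Ch) (m m' : Str) :
    encodeChar c ++ m ≠ Ch.quote :: m' := by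
  cases c <;> simp [encodeChar]

/-- No encoded character begins with a quotation mark, so the first one met at a character boundary
closes the literal. -/
theorem encode_append_quote_inj {s s' m m' : Str}
    (h : encode s ++ Ch.quote :: m = encode s' ++ Ch.quote :: m') : s = s' ∧ m = m' := by
  induction s generalizing s' with
  | nil =>
    cases s' with
    | nil => simpa [encode] using h
    | cons c s' =>
      simp only [encode, List.flatMap_nil, List.nil_append, List.flatMap_cons,
        List.append_assoc] at h
      exact absurd h.symm (encodeChar_append_ne_quote _ _ _)
  | cons c s ih =>
    cases s' with
    | nil =>
      simp only [encode, List.flatMap_nil, List.nil_append, List.flatMap_cons,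
        List.append_assoc] at h
      exact absurd h (encodeChar_append_ne_quote _ _ _)
    | cons c' s' =>
      simp only [encode, List.flatMap_cons, List.append_assoc] at h
      obtain ⟨rfl, h'⟩ := encodeChar_append_inj h
      obtain ⟨rfl, rfl⟩ := ih h'
      exact ⟨rfl, rfl⟩

theorem digits_append_inj {ds ds' : List (Fin 10)} {m m' : Str}
    (hm : ∀ i n, m ≠ Ch.digit i :: n) (hm' : ∀ i n, m' ≠ Ch.digit i :: n)
    (h : ds.map Ch.digit ++ m = ds'.map Ch.digit ++ m') : ds = ds' ∧ m = m' := by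
  induction ds generalizing ds' with
  | nil =>
    cases ds' with
    | nil => simpa using h
    | cons d ds' => exact absurd (by simpa using h) (hm d _)
  | cons d ds ih =>
    cases ds' with
    | nil => exact absurd (by simpa using h.symm) (hm' d _)
    | cons d' ds' =>
      simp only [List.map_cons, List.cons_append, List.cons.injEq, Ch.digit.injEq] at h
      obtain ⟨rfl, rfl⟩ := ih h.2
      exact ⟨by rw [h.1], rfl⟩

/-- The string cannot continue a term. -/
def EndsTerm (m : Str) : Prop :=
  (∀ i n, m ≠ Ch.digit i :: n) ∧ (∀ i n, m ≠ Ch.letter i :: n) ∧ ∀ n, m ≠ Ch.quote :: n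

theorem Item.render_eq_cons (i : Item) :
    ∃ c n, i.render = c :: n ∧ (c = Ch.quote ∨ ∃ k, c = Ch.letter k) := by
  cases i with
  | var x => exact ⟨_, _, rfl, Or.inr ⟨_, rfl⟩⟩
  | lit s => exact ⟨_, _, rfl, Or.inl rfl⟩

theorem EndsTerm.not_digit {m : Str} (hm : EndsTerm m) (is : List Item) (i : Fin 10) (n : Str) :
    is.flatMap Item.render ++ m ≠ Ch.digit i :: n := by
  cases is with
  | nil => simpa using hm.1 i n
  | cons j is =>
    obtain ⟨c, k, hk, rfl | ⟨_, rfl⟩⟩ := j.render_eq_cons <;> simp [hk]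

theorem EndsTerm.not_item {m : Str} (hm : EndsTerm m) (i : Item) (n : Str) :
    m ≠ i.render ++ n := by
  obtain ⟨c, k, hk, rfl | ⟨_, rfl⟩⟩ := i.render_eq_cons
  · rw [hk]; exact hm.2.2 _
  · rw [hk]; exact hm.2.1 _ _

/-- The first character separates variables from literals. The digits of a variable form a maximal
block, because neither a further item nor the remainder can begin with a digit. -/
theorem items_append_inj {is is' : List Item} {m m' : Str} (hm : EndsTerm m) (hm' : EndsTerm m')
    (h : is.flatMap Item.render ++ m = is'.flatMap Item.render ++ m') : is = is' ∧ m = m' := by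
  induction is generalizing is' with
  | nil =>
    cases is' with
    | nil => simpa using h
    | cons i is' =>
      simp only [List.flatMap_nil, List.nil_append, List.flatMap_cons, List.append_assoc] at h
      exact absurd h (hm.not_item _ _)
  | cons i is ih =>
    cases is' with
    | nil =>
      simp only [List.flatMap_nil, List.nil_append, List.flatMap_cons, List.append_assoc] at h
      exact absurd h.symm (hm'.not_item _ _)
    | cons i' is' =>
      simp only [List.flatMap_cons, List.append_assoc] at h
      cases i with
      | var x =>
        cases i' with
        | var x' =>
          obtain ⟨l, ds⟩ := x
          obtain ⟨l', ds'⟩ := x'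
          simp only [Item.render, Var.render, List.cons_append, List.cons.injEq,
            Ch.letter.injEq] at h
          obtain ⟨rfl, h⟩ := h
          obtain ⟨rfl, h'⟩ := digits_append_inj (hm.not_digit _) (hm'.not_digit _) h
          obtain ⟨rfl, rfl⟩ := ih h'
          exact ⟨rfl, rfl⟩
        | lit s' => simp [Item.render, Var.render] at h
      | lit s =>
        cases i' with
        | var x' => simp [Item.render, Var.render] at h
        | lit s' =>
          simp only [Item.render, List.cons_append, List.append_assoc, List.nil_append,
            List.cons.injEq, true_and] at h
          obtain ⟨rfl, h'⟩ := encode_append_quote_inj h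
          obtain ⟨rfl, rfl⟩ := ih h'
          exact ⟨rfl, rfl⟩

theorem Term.render_append_inj {t t' : Term} {m m' : Str} (hm : EndsTerm m) (hm' : EndsTerm m')
    (h : t.render ++ m = t'.render ++ m') : t = t' ∧ m = m' := by
  obtain ⟨is, _⟩ := t
  obtain ⟨is', _⟩ := t'
  obtain ⟨rfl, rfl⟩ := items_append_inj hm hm' h
  exact ⟨rfl, rfl⟩

theorem Var.render_append_colon_inj {x x' : Var} {m m' : Str}
    (h : x.render ++ Ch.colon :: m = x'.render ++ Ch.colon :: m') : x = x' ∧ m = m' := by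
  obtain ⟨l, ds⟩ := x
  obtain ⟨l', ds'⟩ := x'
  simp only [Var.render, List.cons_append, List.cons.injEq, Ch.letter.injEq] at h
  obtain ⟨rfl, h⟩ := h
  obtain ⟨rfl, h⟩ := digits_append_inj (by simp) (by simp) h
  simpa using h

theorem Term.render_eq_cons (t : Term) :
    ∃ c n, t.render = c :: n ∧ (c = Ch.quote ∨ ∃ k, c = Ch.letter k) := by
  obtain ⟨_ | ⟨i, is⟩, h⟩ := t
  · exact absurd rfl h
  · obtain ⟨c, n, hn, hc⟩ := i.render_eq_cons
    exact ⟨c, n ++ is.flatMap Item.render, by simp [Term.render, hn], hc⟩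

/-! ### Reading formulae: leading operand and infix tail -/

namespace Formula

/-- The outermost operator is a binary connective. -/
def IsBinary : Formula → Prop
  | and _ _ => True
  | or _ _ => True
  | imp _ _ => True
  | _ => False

/-- The strings of the binary connectives. -/
inductive Connective : Str → Prop
  | and : Connective [Ch.amp]
  | or : Connective [Ch.bar]
  | imp : Connective [Ch.minus, Ch.gt]

/-- A sequence of connectives, each followed by an operand that is not itself binary. -/
inductive InfixTail : Str → Prop
  | nil : InfixTail []
  | cons {op m : Str} {b : Formula} : Connective op → b.WellParsed → ¬ b.IsBinary →
      InfixTail m → InfixTail (op ++ (b.render ++ m))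

theorem InfixTail.append {m n : Str} (hm : InfixTail m) (hn : InfixTail n) :
    InfixTail (m ++ n) := by
  induction hm with
  | nil => simpa
  | cons hop hb hb' _ ih => simpa using InfixTail.cons hop hb hb' ih

theorem exists_leading_binary {p q : Formula} {op : Str} (hop : Connective op) (hpo : ¬ p.Open)
    (hp : ∃ (a : Formula) (m : Str), a.WellParsed ∧ ¬ a.IsBinary ∧ InfixTail m ∧ p.render = a.render ++ m ∧
      (m = [] → p = a) ∧ (m ≠ [] → ¬ a.Open))
    (hq : ∃ (a : Formula) (m : Str), a.WellParsed ∧ ¬ a.IsBinary ∧ InfixTail m ∧ q.render = a.render ++ m ∧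
      (m = [] → q = a) ∧ (m ≠ [] → ¬ a.Open)) :
    ∃ (a : Formula) (m : Str), a.WellParsed ∧ ¬ a.IsBinary ∧ InfixTail m ∧
      p.render ++ op ++ q.render = a.render ++ m ∧ m ≠ [] ∧ ¬ a.Open := by
  obtain ⟨a, m, ha, hab, hm, hr, h1, h2⟩ := hp
  obtain ⟨b, n, hb, hbb, hn, hs, -, -⟩ := hq
  refine ⟨a, m ++ (op ++ (b.render ++ n)), ha, hab, hm.append (.cons hop hb hbb hn),
    by simp [hr, hs], by cases hop <;> simp, ?_⟩
  by_cases h : m = []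
  · rwa [← h1 h]
  · exact h2 h

/-- The string of a formula begins with an operand that is not itself binary. -/
theorem exists_leading (p : Formula) (hp : p.WellParsed) :
    ∃ (a : Formula) (m : Str), a.WellParsed ∧ ¬ a.IsBinary ∧ InfixTail m ∧ p.render = a.render ++ m ∧
      (m = [] → p = a) ∧ (m ≠ [] → ¬ a.Open) := by
  induction p with
  | eq t u => exact ⟨_, [], hp, by simp [IsBinary], .nil, by simp, fun _ => rfl, by simp⟩
  | ne t u => exact ⟨_, [], hp, by simp [IsBinary], .nil, by simp, fun _ => rfl, by simp⟩
  | paren p => exact ⟨_, [], hp, by simp [IsBinary], .nil, by simp, fun _ => rfl, by simp⟩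
  | neg p => exact ⟨_, [], hp, by simp [IsBinary], .nil, by simp, fun _ => rfl, by simp⟩
  | all x p => exact ⟨_, [], hp, by simp [IsBinary], .nil, by simp, fun _ => rfl, by simp⟩
  | ex x p => exact ⟨_, [], hp, by simp [IsBinary], .nil, by simp, fun _ => rfl, by simp⟩
  | and p q ihp ihq =>
    obtain ⟨a, m, h1, h2, h3, h4, h5, h6⟩ :=
      exists_leading_binary .and hp.2.2.1.2 (ihp hp.1) (ihq hp.2.1)
    exact ⟨a, m, h1, h2, h3, h4, fun h => absurd h h5, fun _ => h6⟩
  | or p q ihp ihq =>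
    obtain ⟨a, m, h1, h2, h3, h4, h5, h6⟩ :=
      exists_leading_binary .or hp.2.2.1.2 (ihp hp.1) (ihq hp.2.1)
    exact ⟨a, m, h1, h2, h3, h4, fun h => absurd h h5, fun _ => h6⟩
  | imp p q ihp ihq =>
    obtain ⟨a, m, h1, h2, h3, h4, h5, h6⟩ :=
      exists_leading_binary .imp hp.2.2.1.2 (ihp hp.1) (ihq hp.2.1)
    exact ⟨a, m, h1, h2, h3, h4, fun h => absurd h h5, fun _ => h6⟩

/-- The string is empty or begins with a closing parenthesis. -/
def Closes (r : Str) : Prop := r = [] ∨ ∃ n, r = Ch.rpar :: n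

theorem Closes.endsTerm {r : Str} (h : Closes r) : EndsTerm r := by
  rcases h with rfl | ⟨n, rfl⟩ <;> simp [EndsTerm]

theorem Connective.not_closes {op m : Str} (h : Connective op) : ¬ Closes (op ++ m) := by
  cases h <;> simp [Closes]

theorem InfixTail.eq_nil_of_closes {m r : Str} (hm : InfixTail m) (h : Closes (m ++ r)) :
    m = [] := by
  cases hm with
  | nil => rfl
  | cons hop hb hb' hm => rw [List.append_assoc] at h; exact absurd h hop.not_closes

theorem InfixTail.endsTerm {m r : Str} (hm : InfixTail m) (hr : Closes r) :
    EndsTerm (m ++ r) := by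
  cases hm with
  | nil => exact hr.endsTerm
  | cons hop hb hb' hm => cases hop <;> simp [EndsTerm]

/-- The string of `g`, up to the next unmatched closing parenthesis, can be read as `g` only. -/
def Unambiguous (g : Formula) : Prop :=
  ∀ (p : Formula) (r r' : Str), p.WellParsed → Closes r → Closes r' →
    p.render ++ r = g.render ++ r' → p = g ∧ r = r'

/-- Reduces a competing reading to its leading operand `a`. Once `a` is known to be `g`, what
follows it closes, whereas a non-empty infix tail begins with a connective; so `a` is the whole
reading. An open `a` cannot have a tail, which is why `m` may be assumed to close in that case. -/
theorem unambiguous_of_leading {g : Formula}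
    (h : ∀ (a : Formula) (m r' : Str), a.WellParsed → ¬ a.IsBinary → EndsTerm m →
      (a.Open → Closes m) → Closes r' → a.render ++ m = g.render ++ r' → a = g ∧ m = r') :
    Unambiguous g := by
  intro p r r' hp hr hr' e
  obtain ⟨a, m, ha, hab, hm, hpm, h1, h2⟩ := exists_leading p hp
  rw [hpm, List.append_assoc] at e
  obtain ⟨rfl, rfl⟩ := h a _ _ ha hab (hm.endsTerm hr) (fun ho => by
    have : m = [] := by by_contra hne; exact h2 hne ho
    simpa [this] using hr) hr' e
  have hm0 := hm.eq_nil_of_closes hr'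
  exact ⟨h1 hm0, by simp [hm0]⟩

theorem Unambiguous.paren_leading {g : Formula} (hg : Unambiguous g) {a : Formula} {m m' : Str}
    (ha : a.WellParsed) (hab : ¬ a.IsBinary)
    (h : a.render ++ m = Ch.lpar :: (g.render ++ Ch.rpar :: m')) : a = paren g ∧ m = m' := by
  cases a with
  | eq t u =>
    obtain ⟨c, n, hn, rfl | ⟨_, rfl⟩⟩ := t.render_eq_cons <;> simp [render, hn] at h
  | ne t u =>
    obtain ⟨c, n, hn, rfl | ⟨_, rfl⟩⟩ := t.render_eq_cons <;> simp [render, hn] at h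
  | paren p =>
    simp only [render, List.append_assoc, List.cons_append, List.nil_append, List.cons.injEq,
      true_and] at h
    obtain ⟨rfl, h⟩ := hg p _ _ ha (Or.inr ⟨_, rfl⟩) (Or.inr ⟨_, rfl⟩) h
    exact ⟨rfl, by simpa using h⟩
  | neg p => simp [render] at h
  | and p q => exact absurd trivial hab
  | or p q => exact absurd trivial hab
  | imp p q => exact absurd trivial hab
  | all x p => simp [render] at h
  | ex x p => simp [render] at h

theorem unambiguous_eq (t u : Term) : Unambiguous (eq t u) := by
  refine unambiguous_of_leading fun a m r' ha hab hm _ hr' h => ?_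
  obtain ⟨c, n, hn, hc⟩ := t.render_eq_cons
  cases a with
  | eq t' u' =>
    simp only [render, List.append_assoc, List.cons_append, List.nil_append] at h
    obtain ⟨rfl, h'⟩ := Term.render_append_inj (by simp [EndsTerm]) (by simp [EndsTerm]) h
    simp only [List.cons.injEq, true_and] at h'
    obtain ⟨rfl, rfl⟩ := Term.render_append_inj hm hr'.endsTerm h'
    exact ⟨rfl, rfl⟩
  | ne t' u' =>
    simp only [render, List.append_assoc, List.cons_append, List.nil_append] at h
    obtain ⟨-, h'⟩ := Term.render_append_inj (by simp [EndsTerm]) (by simp [EndsTerm]) h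
    simp at h'
  | and p q => exact absurd trivial hab
  | or p q => exact absurd trivial hab
  | imp p q => exact absurd trivial hab
  | paren p => rcases hc with rfl | ⟨_, rfl⟩ <;> simp [render, hn] at h
  | neg p => rcases hc with rfl | ⟨_, rfl⟩ <;> simp [render, hn] at h
  | all x p => rcases hc with rfl | ⟨_, rfl⟩ <;> simp [render, hn] at h
  | ex x p => rcases hc with rfl | ⟨_, rfl⟩ <;> simp [render, hn] at h

theorem Unambiguous.neg_paren {g : Formula} (hg : Unambiguous g) :
    Unambiguous (neg (paren g)) := by
  refine unambiguous_of_leading fun a m r' ha hab hm _ hr' h => ?_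
  cases a with
  | eq t u =>
    obtain ⟨c, n, hn, rfl | ⟨_, rfl⟩⟩ := t.render_eq_cons <;> simp [render, hn] at h
  | ne t u =>
    obtain ⟨c, n, hn, rfl | ⟨_, rfl⟩⟩ := t.render_eq_cons <;> simp [render, hn] at h
  | paren p => simp [render] at h
  | neg p =>
    -- Negation binds tighter than the connectives, so its operand can only be non-binary; this
    -- rules out reading the negation as reaching past the parenthesis.
    have hpb : ¬ p.IsBinary := by
      have := ha.2
      cases p <;> simp_all [IsBinary, RightOperand, prec]
    simp only [render, List.append_assoc, List.cons_append, List.nil_append, List.cons.injEq,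
      true_and] at h
    obtain ⟨rfl, rfl⟩ := hg.paren_leading ha.1 hpb h
    exact ⟨rfl, rfl⟩
  | and p q => exact absurd trivial hab
  | or p q => exact absurd trivial hab
  | imp p q => exact absurd trivial hab
  | all x p => simp [render] at h
  | ex x p => simp [render] at h

theorem Unambiguous.all {g : Formula} (hg : Unambiguous g) (x : Var) :
    Unambiguous (all x g) := by
  refine unambiguous_of_leading fun a m r' ha hab _ ho hr' h => ?_
  cases a with
  | eq t u =>
    obtain ⟨c, n, hn, rfl | ⟨_, rfl⟩⟩ := t.render_eq_cons <;> simp [render, hn] at h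
  | ne t u =>
    obtain ⟨c, n, hn, rfl | ⟨_, rfl⟩⟩ := t.render_eq_cons <;> simp [render, hn] at h
  | paren p => simp [render] at h
  | neg p => simp [render] at h
  | and p q => exact absurd trivial hab
  | or p q => exact absurd trivial hab
  | imp p q => exact absurd trivial hab
  | all y p =>
    simp only [render, List.append_assoc, List.cons_append, List.nil_append, List.cons.injEq,
      true_and] at h
    obtain ⟨rfl, h'⟩ := Var.render_append_colon_inj h
    obtain ⟨rfl, rfl⟩ := hg p _ _ ha (ho trivial) hr' h'
    exact ⟨rfl, rfl⟩
  | ex x p => simp [render] at h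

/-- The case analysis on the operator of a binary formula whose string is `(g)->(h)`. -/
theorem Unambiguous.imp_operands {g g' p q : Formula} (hg : Unambiguous g)
    (hg' : Unambiguous g') (hp : p.WellParsed) (hq : q.WellParsed) {op r r' : Str}
    (hop : Connective op) (hr' : Closes r')
    (h : p.render ++ (op ++ (q.render ++ r)) = Ch.lpar :: (g.render ++ Ch.rpar :: Ch.minus ::
      Ch.gt :: Ch.lpar :: (g'.render ++ Ch.rpar :: r'))) :
    p = paren g ∧ op = [Ch.minus, Ch.gt] ∧ q = paren g' ∧ r = r' := by
  obtain ⟨a, m, ha, hab, hm, hpm, h1, -⟩ := exists_leading p hp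
  rw [hpm, List.append_assoc] at h
  obtain ⟨rfl, h'⟩ := hg.paren_leading ha hab h
  clear h
  cases hm with
  | nil =>
    obtain ⟨b, n, hb, hbb, hn, hqn, h2, -⟩ := exists_leading q hq
    have : op = [Ch.minus, Ch.gt] ∧
        q.render ++ r = Ch.lpar :: (g'.render ++ Ch.rpar :: r') := by
      clear h1 hpm
      cases hop with
      | imp => simpa using h'
      | _ => simp at h'
    obtain ⟨rfl, h⟩ := this
    rw [hqn, List.append_assoc] at h
    obtain ⟨rfl, rfl⟩ := hg'.paren_leading hb hbb h
    have hn0 := hn.eq_nil_of_closes hr'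
    exact ⟨h1 rfl, rfl, h2 hn0, by simp [hn0]⟩
  -- Here `p` already uses up both parenthesised operands, so the connective `op` would have to
  -- stand where the string closes.
  | @cons op' n b hop' hb hbb hn =>
    have : b.render ++ (n ++ (op ++ (q.render ++ r))) =
        Ch.lpar :: (g'.render ++ Ch.rpar :: r') := by
      clear h1 hpm
      cases hop' with
      | imp => simpa using h'
      | _ => simp at h'
    obtain ⟨rfl, rfl⟩ := hg'.paren_leading hb hbb this
    have hn0 := hn.eq_nil_of_closes hr'
    rw [hn0, List.nil_append] at hr'
    exact absurd hr' hop.not_closes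

theorem Unambiguous.imp_paren {g g' : Formula} (hg : Unambiguous g) (hg' : Unambiguous g') :
    Unambiguous (imp (paren g) (paren g')) := by
  intro p r r' hp hr hr' h
  have e : (imp (paren g) (paren g')).render ++ r' = Ch.lpar :: (g.render ++ Ch.rpar :: Ch.minus ::
      Ch.gt :: Ch.lpar :: (g'.render ++ Ch.rpar :: r')) := by simp [render]
  rw [e] at h
  by_cases hpb : p.IsBinary
  · cases p with
    | and p q =>
      have := hg.imp_operands hg' hp.1 hp.2.1 .and hr' (r := r) (by simpa [render] using h)
      simp at this
    | or p q =>
      have := hg.imp_operands hg' hp.1 hp.2.1 .or hr' (r := r) (by simpa [render] using h)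
      simp at this
    | imp p q =>
      obtain ⟨rfl, -, rfl, rfl⟩ :=
        hg.imp_operands hg' hp.1 hp.2.1 .imp hr' (r := r) (by simpa [render] using h)
      exact ⟨rfl, rfl⟩
    | _ => exact absurd hpb (by simp [IsBinary])
  -- A non-binary reading would be the first parenthesis alone, leaving a remainder that begins with
  -- the arrow.
  · obtain ⟨-, rfl⟩ := hg.paren_leading hp hpb h
    exact absurd hr (by simp [Closes])

theorem Unambiguous.readsAs_eq {g p : Formula} (hg : Unambiguous g)
    (h : ReadsAs g.render p) : p = g :=
  (hg p [] [] h.1 (Or.inl rfl) (Or.inl rfl) (by simp [h.2])).1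

end Formula

/-! ### Coding sequences of strings -/

/-- The delimiter `d` does not occur in the string `u`. -/
def Avoids (d u : Str) : Prop := ∀ a b : Str, u ≠ a ++ d ++ b

/-- The strings `ws`, each of them preceded by the delimiter `d`, and a final delimiter. -/
def history (d : Str) : List Str → Str
  | [] => d
  | w :: ws => d ++ w ++ history d ws

/-- A delimiter that can occur neither in nor across the borders of strings of length below `k`. -/
def delimiter (k : ℕ) : Str := Ch.plus :: List.replicate k Ch.star

/-- At position `x.length`, between 1 and `k`, the left side has a star of the delimiter and the
right side has its plus. -/
theorem delimiter_shift {k : ℕ} {x r r' : Str} (hx : x ≠ []) (hk : x.length ≤ k) :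
    delimiter k ++ r ≠ x ++ delimiter k ++ r' := by
  intro h
  have h1 := congrArg (fun l => l[x.length]?) h
  have h2 : x.length ≠ 0 := by simpa using hx
  obtain ⟨n, hn⟩ := Nat.exists_eq_succ_of_ne_zero h2
  simp only [List.append_assoc, List.getElem?_append_right le_rfl, Nat.sub_self] at h1
  rw [List.getElem?_append_left (by simp [delimiter]; omega), hn] at h1
  have : n < k := by omega
  simp [delimiter, this] at h1

theorem avoids_delimiter {k : ℕ} {w : Str} (hw : w.length ≤ k) : Avoids (delimiter k) w := by
  rintro a b rfl
  simp [delimiter] at hw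
  omega

/-- If one of `u`, `w` exceeded the other by `x`, a short `x` would be a forbidden shift of the
delimiter, and a long one would put a complete delimiter inside `u`. Only `w` is assumed short: `u`
will be an arbitrary segment cut out by a formula. -/
theorem delimiter_first {k : ℕ} {u w r r' : Str} (hw : w.length ≤ k) (hu : Avoids (delimiter k) u)
    (h : u ++ delimiter k ++ r = w ++ delimiter k ++ r') : u = w ∧ r = r' := by
  have key : u = w := by
    rw [List.append_assoc, List.append_assoc, List.append_eq_append_iff] at h
    rcases h with ⟨x, rfl, h⟩ | ⟨x, rfl, h⟩
    · by_cases hx : x = []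
      · simp [hx]
      · exact absurd (by simpa using h) (delimiter_shift hx (by simp at hw; omega))
    · by_cases hx : x = []
      · simp [hx]
      · by_cases hk : x.length ≤ k
        · exact absurd (by simpa using h) (delimiter_shift hx hk)
        · rw [List.append_eq_append_iff] at h
          rcases h with ⟨y, rfl, -⟩ | ⟨y, hy, -⟩
          · exact absurd (by simp) (hu w y)
          · have := congrArg List.length hy
            have hy0 : y = [] := by
              simp [delimiter] at this
              exact List.eq_nil_of_length_eq_zero (by omega)
            subst hy0
            exact absurd (by simp at hy; simp [hy]) (hu w [])
  subst key
  simpa using h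

theorem history_eq_append (d : Str) (ws : List Str) : ∃ r, history d ws = d ++ r := by
  cases ws with
  | nil => exact ⟨[], by simp [history]⟩
  | cons w ws => exact ⟨w ++ history d ws, by simp [history]⟩

/-- Delimiters cannot overlap each other or the short entries in an unintended way, so a segment
that avoids the delimiter and lies between two delimiters is an entry. -/
theorem history_split {k : ℕ} {ws : List Str} (hws : ∀ w ∈ ws, w.length ≤ k) {p u r : Str}
    (hu : Avoids (delimiter k) u)
    (h : history (delimiter k) ws = p ++ delimiter k ++ u ++ delimiter k ++ r) :
    ∃ ws₁ ws₂, ws = ws₁ ++ u :: ws₂ ∧ delimiter k ++ r = history (delimiter k) ws₂ := by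
  induction ws generalizing p with
  | nil =>
    have := congrArg List.length h
    simp [history, delimiter] at this
    omega
  | cons w ws ih =>
    have hw := hws w (by simp)
    obtain ⟨t, ht⟩ := history_eq_append (delimiter k) ws
    by_cases hp : p = []
    · subst hp
      simp only [history, ht, List.nil_append, List.append_assoc,
        List.append_cancel_left_eq] at h
      obtain ⟨rfl, rfl⟩ := delimiter_first hw hu (by simpa using h.symm)
      exact ⟨[], ws, by simp, ht.symm⟩
    · have hp' : ¬ p.length ≤ k := fun hk => by
        simp only [history, List.append_assoc] at h
        exact delimiter_shift hp hk (by simpa using h)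
      simp only [history, List.append_assoc] at h
      have h' := h
      rw [List.append_eq_append_iff] at h'
      obtain ⟨x, rfl, h1⟩ : ∃ x, p = delimiter k ++ x ∧
          w ++ history (delimiter k) ws = x ++ (delimiter k ++ (u ++ (delimiter k ++ r))) := by
        rcases h' with ⟨x, h1, h2⟩ | ⟨x, h1, h2⟩
        · exact ⟨x, h1, h2⟩
        · have := congrArg List.length h1
          have hx : x = [] := by
            simp [delimiter] at this
            exact List.eq_nil_of_length_eq_zero (by omega)
          subst hx
          exact ⟨[], by simpa using h1.symm, by simpa using h2.symm⟩
      rw [List.append_eq_append_iff] at h1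
      obtain ⟨y, rfl, h2⟩ : ∃ y, x = w ++ y ∧
          history (delimiter k) ws = y ++ (delimiter k ++ (u ++ (delimiter k ++ r))) := by
        rcases h1 with ⟨y, h2, h3⟩ | ⟨y, rfl, h3⟩
        · exact ⟨y, h2, h3⟩
        · by_cases hy : y = []
          · exact ⟨[], by simp [hy], by simpa [hy] using h3.symm⟩
          · rw [ht] at h3
            exact absurd (by simpa using h3) (delimiter_shift hy (by simp at hw; omega))
      obtain ⟨ws₁, ws₂, rfl, h4⟩ := ih (fun w hw => hws w (by simp [hw])) (p := y) (by simp [h2])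
      exact ⟨w :: ws₁, ws₂, by simp, h4⟩

/-- The string `h` codes, with the delimiter `d`, a sequence of related strings from `w₀` to a
string in `H`. -/
def CodesRun (S : Str → Str → Prop) (H : Str → Prop) (w₀ d h : Str) : Prop :=
  Avoids d w₀ ∧ (∃ r, h = d ++ w₀ ++ d ++ r) ∧
    ∀ p u r, h = p ++ d ++ u ++ d ++ r → Avoids d u →
      H u ∨ ∃ u' r', r = u' ++ d ++ r' ∧ Avoids d u' ∧ S u u'

theorem exists_codesRun_iff (S : Str → Str → Prop) (H : Str → Prop) (w₀ : Str) :
    (∃ d h, CodesRun S H w₀ d h) ↔ ∃ w, Relation.ReflTransGen S w₀ w ∧ H w := by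
  constructor
  · rintro ⟨d, h, h0, ⟨r, hr⟩, hstep⟩
    -- Induction on the length of what remains. The delimiter is non-empty, since the empty string
    -- occurs everywhere; so each successor shortens the remainder, and the chain must end in `H`.
    have key : ∀ (n : ℕ) (p u r : Str), r.length ≤ n → h = p ++ d ++ u ++ d ++ r → Avoids d u →
        ∃ w, Relation.ReflTransGen S u w ∧ H w := by
      intro n
      induction n with
      | zero =>
        intro p u r hn e hu
        rcases hstep p u r e hu with hH | ⟨u', r', rfl, hu', hS⟩
        · exact ⟨u, .refl, hH⟩
        · have hd : d = [] := by
            simp only [List.length_append] at hn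
            exact List.eq_nil_of_length_eq_zero (by omega)
          exact absurd (by simp [hd]) (hu [] u)
      | succ n ih =>
        intro p u r hn e hu
        rcases hstep p u r e hu with hH | ⟨u', r', rfl, hu', hS⟩
        · exact ⟨u, .refl, hH⟩
        · have hd : d.length ≠ 0 := fun hd =>
            hu [] u (by simp [List.eq_nil_of_length_eq_zero hd])
          simp only [List.length_append] at hn
          obtain ⟨w, hw, hH⟩ := ih (p ++ d ++ u) u' r' (by omega) (by simp [e]) hu'
          exact ⟨w, .head hS hw, hH⟩
    exact key _ [] w₀ r le_rfl (by simpa using hr) h0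
  · rintro ⟨w, hw, hH⟩
    obtain ⟨ws, hchain, hlast⟩ := List.exists_isChain_cons_of_relationReflTransGen hw
    -- Any common bound on the lengths of the entries would do.
    set k := ((w₀ :: ws).map List.length).sum with hk
    have hle : ∀ v ∈ w₀ :: ws, v.length ≤ k := fun v hv =>
      List.single_le_sum (by simp) _ (List.mem_map_of_mem hv)
    refine ⟨delimiter k, history (delimiter k) (w₀ :: ws), avoids_delimiter (hle _ (by simp)),
      ?_, fun p u r e hu => ?_⟩
    · obtain ⟨r, hr⟩ := history_eq_append (delimiter k) ws
      exact ⟨r, by simp [history, hr]⟩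
    · obtain ⟨ws₁, ws₂, hsplit, hr⟩ := history_split hle hu e
      cases ws₂ with
      | nil =>
        left
        have : u = w := by
          rw [← hlast]; simp [hsplit]
        rwa [this]
      | cons u' ws₂ =>
        right
        obtain ⟨r', hr'⟩ := history_eq_append (delimiter k) ws₂
        refine ⟨u', r', ?_, avoids_delimiter (hle u' (by simp [hsplit])), ?_⟩
        · simpa [history, hr'] using hr
        · rw [hsplit] at hchain
          have := (List.isChain_append.1 hchain).2.1
          exact (List.isChain_cons_cons.1 this).1

/-! ### Turing machines as string rewriting systems -/

def allChars : List Ch :=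
  (List.finRange 26).map Ch.letter ++ (List.finRange 10).map Ch.digit ++
    [.quote, .backslash, .eq, .ne, .lpar, .rpar, .tilde, .amp, .bar, .minus, .gt, .bigA, .bigE,
      .colon, .plus, .star, .lt]

theorem mem_allChars (c : Ch) : c ∈ allChars := by
  cases c <;> simp [allChars]

def allSymbols : List Symbol := none :: allChars.map some

theorem mem_allSymbols (c : Symbol) : c ∈ allSymbols := by
  cases c <;> simp [allSymbols, mem_allChars]

/-- The code of a tape symbol: two characters other than `+`. -/
def symbolCode : Symbol → Str
  | none => [.star, .star]
  | some .plus => [.star, .tilde]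
  | some c => [c, .colon]

theorem symbolCode_length (c : Symbol) : (symbolCode c).length = 2 := by
  unfold symbolCode; split <;> rfl

theorem plus_notMem_symbolCode (c : Symbol) : Ch.plus ∉ symbolCode c := by
  unfold symbolCode; split <;> simp_all [eq_comm]

theorem symbolCode_injective : Function.Injective symbolCode := by
  intro a b h
  unfold symbolCode at h
  split at h <;> split at h <;> simp_all

def tapeCode (L : List Symbol) : Str := L.flatMap symbolCode

theorem plus_notMem_tapeCode (L : List Symbol) : Ch.plus ∉ tapeCode L := by
  simp [tapeCode, plus_notMem_symbolCode]

theorem tapeCode_append (L L' : List Symbol) :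
    tapeCode (L ++ L') = tapeCode L ++ tapeCode L' := by
  simp [tapeCode]

theorem tapeCode_eq_append {L a : List Symbol} {l : Str} (h : tapeCode L = tapeCode a ++ l) :
    ∃ L', L = a ++ L' ∧ l = tapeCode L' := by
  induction a generalizing L with
  | nil => exact ⟨L, rfl, h.symm⟩
  | cons c a ih =>
    cases L with
    | nil =>
      have := congrArg List.length h
      simp [tapeCode, symbolCode_length] at this
      omega
    | cons c' L =>
      simp only [tapeCode, List.flatMap_cons, List.append_assoc] at h
      obtain ⟨h1, h2⟩ := List.append_inj h (by simp [symbolCode_length])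
      obtain ⟨L', rfl, rfl⟩ := ih h2
      exact ⟨L', by rw [symbolCode_injective h1]; rfl, rfl⟩

def stateCode (q : ℕ) : Str := List.replicate q (Ch.letter 0)

theorem plus_notMem_stateCode (q : ℕ) : Ch.plus ∉ stateCode q := by
  simp [stateCode]

/-- The code of a configuration: the cells to the left of the head, the state, and the cells from
the head on, of which the last ones may still be given as part `Y` of the input. -/
def configCode (L : List Symbol) (q : ℕ) (X : List Symbol) (Y : Str) : Str :=
  tapeCode L ++ Ch.plus :: (stateCode q ++ Ch.plus :: (tapeCode X ++ Ch.plus :: Y))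

theorem append_plus_inj {u v m n : Str} (hu : Ch.plus ∉ u) (hv : Ch.plus ∉ v)
    (h : u ++ Ch.plus :: m = v ++ Ch.plus :: n) : u = v ∧ m = n := by
  induction u generalizing v with
  | nil =>
    cases v with
    | nil => simpa using h
    | cons c v =>
      simp only [List.nil_append, List.cons_append, List.cons.injEq] at h
      simp [← h.1] at hv
  | cons c u ih =>
    cases v with
    | nil =>
      simp only [List.nil_append, List.cons_append, List.cons.injEq] at h
      simp [h.1] at hu
    | cons c' v =>
      simp only [List.mem_cons, not_or, List.cons_append, List.cons.injEq] at hu hv h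
      obtain ⟨rfl, rfl⟩ := ih hu.2 hv.2 h.2
      exact ⟨by rw [h.1], rfl⟩

/-- The first three plus signs are the block borders, because the blocks before them contain none.
The unread input `Y` comes last and may contain plus signs. It stays uncoded so that the initial
code is a fixed string followed by the input, which a term can express. -/
theorem configCode_decode {L X a b : List Symbol} {q q' : ℕ} {Y l x y : Str}
    (hl : Ch.plus ∉ l) (hx : Ch.plus ∉ x)
    (h : configCode L q X Y = tapeCode a ++ l ++ Ch.plus ::
      (stateCode q' ++ Ch.plus :: (tapeCode b ++ x ++ Ch.plus :: y))) :
    ∃ L' X', L = a ++ L' ∧ l = tapeCode L' ∧ q = q' ∧ X = b ++ X' ∧ x = tapeCode X' ∧ Y = y := by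
  obtain ⟨h1, h⟩ := append_plus_inj (plus_notMem_tapeCode L)
    (by simp [plus_notMem_tapeCode, hl]) h
  obtain ⟨h2, h⟩ := append_plus_inj (plus_notMem_stateCode q) (plus_notMem_stateCode q') h
  obtain ⟨h3, rfl⟩ := append_plus_inj (plus_notMem_tapeCode X)
    (by simp [plus_notMem_tapeCode, hx]) h
  obtain ⟨L', rfl, rfl⟩ := tapeCode_eq_append h1
  obtain ⟨X', rfl, rfl⟩ := tapeCode_eq_append h3
  refine ⟨L', X', rfl, rfl, ?_, rfl, rfl, rfl⟩
  simpa [stateCode] using congrArg List.length h2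

/-- A rewriting rule for codes of configurations. On the left of the head, the prefix `pop` is
replaced by `push` and `pad` is appended; on the right, the prefix `read` is replaced by `write` and
`extend` is appended; from the remaining input, which must have no further characters if `last` is
true, the prefix `input` is removed; the state changes from `source` to `target`. -/
structure Production where
  source : ℕ
  target : ℕ
  pop : List Symbol := []
  push : List Symbol := []
  pad : List Symbol := []
  read : List Symbol := []
  write : List Symbol := []
  extend : List Symbol := []
  input : Str := []
  last : Bool := false

def Production.Applies (P : Production) (w w' : Str) : Prop :=
  ∃ l x y : Str, Ch.plus ∉ l ∧ Ch.plus ∉ x ∧ (P.last = true → y = []) ∧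
    w = tapeCode P.pop ++ l ++ Ch.plus :: (stateCode P.source ++ Ch.plus ::
      (tapeCode P.read ++ x ++ Ch.plus :: (P.input ++ y))) ∧
    w' = tapeCode P.push ++ l ++ tapeCode P.pad ++ Ch.plus :: (stateCode P.target ++ Ch.plus ::
      (tapeCode P.write ++ x ++ tapeCode P.extend ++ Ch.plus :: y))

theorem Production.applies_configCode (P : Production) {L X : List Symbol} {q : ℕ} {Y w' : Str} :
    P.Applies (configCode L q X Y) w' ↔ ∃ L' X' Y', L = P.pop ++ L' ∧ q = P.source ∧
      X = P.read ++ X' ∧ Y = P.input ++ Y' ∧ (P.last = true → Y' = []) ∧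
      w' = configCode (P.push ++ L' ++ P.pad) P.target (P.write ++ X' ++ P.extend) Y' := by
  constructor
  · rintro ⟨l, x, y, hl, hx, hy, h, rfl⟩
    obtain ⟨L', X', rfl, rfl, rfl, rfl, rfl, rfl⟩ := configCode_decode hl hx h
    exact ⟨L', X', y, rfl, rfl, rfl, rfl, hy, by simp [configCode, tapeCode_append]⟩
  · rintro ⟨L', X', Y', rfl, rfl, rfl, rfl, hy, rfl⟩
    exact ⟨tapeCode L', tapeCode X', Y', plus_notMem_tapeCode _, plus_notMem_tapeCode _, hy,
      by simp [configCode, tapeCode_append], by simp [configCode, tapeCode_append]⟩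

/-! ### The productions of a machine and their simulation of its steps -/

namespace TuringMachine

def padLeft (q : ℕ) : Production := { source := q, target := q, pad := [none] }

/-- The blank may be added only when the input is used up; otherwise it would be inserted in front
of unread characters. -/
def padRight (q : ℕ) : Production := { source := q, target := q, extend := [none], last := true }

def fetch (q : ℕ) (c : Ch) : Production :=
  { source := q, target := q, extend := [some c], input := [c] }

/-- The production for reading `c` in state `q`, with `b` on the left of the head. -/
def ruleProduction (q : ℕ) (b c : Symbol) : Symbol × ℕ × Move → Production
  | (c', q', .L) => { source := q, target := q', pop := [b], read := [c], write := [b, c'] }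
  | (c', q', .R) => { source := q, target := q', read := [c], push := [c'] }
  | (c', q', .N) => { source := q, target := q', read := [c], write := [c'] }

variable (M : TuringMachine)

def productions : List Production :=
  (List.finRange (M.r + 1)).flatMap fun (q : Fin (M.r + 1)) =>
    [padLeft q, padRight q] ++ allChars.map (fetch q) ++
      if h : q = 0 then [] else allSymbols.flatMap fun b => allSymbols.map fun c =>
        ruleProduction q b c ((M.rule c q h).1, (M.rule c q h).2.1, (M.rule c q h).2.2)

theorem mem_productions {P : Production} : P ∈ M.productions ↔ ∃ q : Fin (M.r + 1),
    P = padLeft q ∨ P = padRight q ∨ (∃ c, P = fetch q c) ∨ ∃ (h : q ≠ 0) (b c : Symbol),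
      P = ruleProduction q b c ((M.rule c q h).1, (M.rule c q h).2.1, (M.rule c q h).2.2) := by
  simp only [productions, List.mem_flatMap, List.mem_finRange, true_and, List.mem_append,
    List.mem_cons, List.not_mem_nil, or_false, List.mem_map, mem_allChars, or_assoc]
  refine exists_congr fun q => or_congr_right (or_congr_right (or_congr ?_ ?_))
  · exact exists_congr fun c => eq_comm
  · by_cases h : q = 0
    · simp [h]
    · simp [h, mem_allSymbols, eq_comm]

def Rewrites (w w' : Str) : Prop := ∃ P ∈ M.productions, P.Applies w w'

variable {M}

/-- The string is a code of the configuration. -/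
def Represents (w : Str) (c : M.Config) : Prop :=
  ∃ L X Y, w = configCode L c.state X Y ∧ c.tape = Turing.Tape.mk₂ L (X ++ Y.map some)

theorem mk_append_blank (L : List Symbol) :
    Turing.ListBlank.mk (L ++ [none]) = Turing.ListBlank.mk L :=
  Quotient.sound (Or.inr ⟨1, rfl⟩)

/-- Rewriting is nondeterministic but sound: padding and fetching change the code and not the
configuration, and every other production is one machine step. -/
theorem Represents.rewrites {w w' : Str} {c : M.Config} (h : Represents w c)
    (hw : M.Rewrites w w') :
    ∃ c', Relation.ReflTransGen (fun a b => M.step a = some b) c c' ∧ Represents w' c' := by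
  obtain ⟨L, X, Y, rfl, ht⟩ := h
  obtain ⟨P, hP, hw⟩ := hw
  obtain ⟨L', X', Y', rfl, hq, rfl, rfl, hy, rfl⟩ := P.applies_configCode.1 hw
  obtain ⟨q, rfl | rfl | ⟨a, rfl⟩ | ⟨hq0, b, a, rfl⟩⟩ := M.mem_productions.1 hP
  · refine ⟨c, .refl, L' ++ [none], X', Y', by simp [padLeft, hq], ?_⟩
    simp [padLeft] at ht
    rw [ht, Turing.Tape.mk₂, Turing.Tape.mk₂, mk_append_blank]
  · refine ⟨c, .refl, L', X' ++ [none], Y', by simp [padRight, hq], ?_⟩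
    obtain rfl := hy rfl
    simp [padRight] at ht
    simp [ht, Turing.Tape.mk₂, mk_append_blank]
  · refine ⟨c, .refl, L', X' ++ [some a], Y', by simp [fetch, hq], ?_⟩
    simpa [fetch] using ht
  · obtain rfl : c.state = q := by
      apply Fin.ext
      rw [hq]
      unfold ruleProduction; split <;> rfl
    refine ⟨⟨(M.rule a c.state hq0).2.1, (M.rule a c.state hq0).2.2.apply
      (c.tape.write (M.rule a c.state hq0).1)⟩, .single ?_, ?_⟩
    · have : c.tape.head = a := by
        rw [ht]
        unfold ruleProduction
        split <;> simp [Turing.Tape.mk₂]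
      simp [step, hq0, this]
    · revert ht
      generalize M.rule a c.state hq0 = t
      obtain ⟨a', q', d⟩ := t
      cases d <;> intro ht
      · refine ⟨L', b :: a' :: X', Y', by simp [ruleProduction], ?_⟩
        simp only [ruleProduction] at ht
        simp [ht, Move.apply, Turing.Tape.mk₂]
      · refine ⟨a' :: L', X', Y', by simp [ruleProduction], ?_⟩
        simp only [ruleProduction] at ht
        simp [ht, Move.apply, Turing.Tape.mk₂]
      · refine ⟨L', a' :: X', Y', by simp [ruleProduction], ?_⟩
        simp only [ruleProduction] at ht
        simp [ht, Move.apply, Turing.Tape.mk₂]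

theorem rewrites_left (L X : List Symbol) (q : Fin (M.r + 1)) (Y : Str) :
    ∃ b L', Relation.ReflTransGen M.Rewrites (configCode L q X Y) (configCode (b :: L') q X Y) ∧
      Turing.ListBlank.mk (b :: L') = Turing.ListBlank.mk L := by
  cases L with
  | nil =>
    refine ⟨none, [], .single ⟨padLeft q, M.mem_productions.2 ⟨q, .inl rfl⟩, ?_⟩,
      mk_append_blank []⟩
    exact (padLeft q).applies_configCode.2
      ⟨[], X, Y, rfl, rfl, rfl, rfl, by simp [padLeft], by simp [padLeft]⟩
  | cons b L => exact ⟨b, L, .refl, rfl⟩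

theorem rewrites_right (L X : List Symbol) (q : Fin (M.r + 1)) (Y : Str) :
    ∃ a X' Y', Relation.ReflTransGen M.Rewrites (configCode L q X Y)
        (configCode L q (a :: X') Y') ∧
      Turing.ListBlank.mk (a :: X' ++ Y'.map some) =
        Turing.ListBlank.mk (X ++ Y.map some : List Symbol) := by
  cases X with
  | nil =>
    cases Y with
    | nil =>
      refine ⟨none, [], [], .single ⟨padRight q, M.mem_productions.2 ⟨q, .inr (.inl rfl)⟩, ?_⟩,
        mk_append_blank []⟩
      exact (padRight q).applies_configCode.2
        ⟨L, [], [], rfl, rfl, rfl, rfl, by simp, by simp [padRight]⟩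
    | cons c Y =>
      refine ⟨some c, [], Y,
        .single ⟨fetch q c, M.mem_productions.2 ⟨q, .inr (.inr (.inl ⟨c, rfl⟩))⟩, ?_⟩, by simp⟩
      exact (fetch q c).applies_configCode.2
        ⟨L, [], Y, rfl, rfl, rfl, rfl, by simp [fetch], by simp [fetch]⟩
  | cons a X => exact ⟨a, X, Y, .refl, rfl⟩

/-- Padding or fetching first makes a cell explicit on each side of the head; then the production
for these two cells applies. -/
theorem Represents.step {w : Str} {c c' : M.Config} (h : Represents w c)
    (hc : M.step c = some c') :
    ∃ w', Relation.ReflTransGen M.Rewrites w w' ∧ Represents w' c' := by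
  obtain ⟨L, X, Y, rfl, ht⟩ := h
  obtain ⟨a, X, Y, h1, h2⟩ := rewrites_right (M := M) L X c.state Y
  obtain ⟨b, L, h3, h4⟩ := rewrites_left (M := M) L (a :: X) c.state Y
  rw [Turing.Tape.mk₂, ← h2, ← h4] at ht
  have hq : c.state ≠ 0 := fun hq => by simp [TuringMachine.step, hq] at hc
  have ha : c.tape.head = a := by simp [ht]
  simp only [TuringMachine.step, hq, dite_false, ha, Option.some.injEq] at hc
  subst hc
  suffices ∃ w', M.Rewrites (configCode (b :: L) c.state (a :: X) Y) w' ∧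
      Represents w' (M := M) ⟨(M.rule a c.state hq).2.1, (M.rule a c.state hq).2.2.apply
        (c.tape.write (M.rule a c.state hq).1)⟩ by
    obtain ⟨w', h5, h6⟩ := this
    exact ⟨w', (h1.trans h3).tail h5, h6⟩
  have hP := M.mem_productions.2 ⟨c.state, .inr (.inr (.inr ⟨hq, b, a, rfl⟩))⟩
  revert hP
  generalize M.rule a c.state hq = t
  obtain ⟨a', q', d⟩ := t
  cases d <;> intro hP
  · exact ⟨_, ⟨_, hP, (Production.applies_configCode _).2
      ⟨L, X, Y, rfl, rfl, rfl, rfl, by simp [ruleProduction], rfl⟩⟩,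
      L, b :: a' :: X, Y, by simp [ruleProduction], by simp [ht, Move.apply, Turing.Tape.mk₂]⟩
  · exact ⟨_, ⟨_, hP, (Production.applies_configCode _).2
      ⟨b :: L, X, Y, rfl, rfl, rfl, rfl, by simp [ruleProduction], rfl⟩⟩,
      a' :: b :: L, X, Y, by simp [ruleProduction], by simp [ht, Move.apply, Turing.Tape.mk₂]⟩
  · exact ⟨_, ⟨_, hP, (Production.applies_configCode _).2
      ⟨b :: L, X, Y, rfl, rfl, rfl, rfl, by simp [ruleProduction], rfl⟩⟩,
      b :: L, a' :: X, Y, by simp [ruleProduction], by simp [ht, Move.apply, Turing.Tape.mk₂]⟩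

/-- The string has the form of a code of a configuration with the final state. -/
def CodesFinal (w : Str) : Prop := ∃ l r, Ch.plus ∉ l ∧ w = l ++ Ch.plus :: Ch.plus :: r

theorem Represents.codesFinal_iff {w : Str} {c : M.Config} (h : Represents w c) :
    CodesFinal w ↔ c.state = 0 := by
  obtain ⟨L, X, Y, rfl, -⟩ := h
  constructor
  · rintro ⟨l, r, hl, h⟩
    obtain ⟨-, h⟩ := append_plus_inj (plus_notMem_tapeCode L) hl h
    -- States are written in unary, so two adjacent plus signs mean state 0.
    have := (append_plus_inj (v := []) (plus_notMem_stateCode _) (by simp) h).1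
    apply Fin.ext
    simpa [stateCode] using congrArg List.length this
  · intro h
    exact ⟨tapeCode L, _, plus_notMem_tapeCode L, by simp [configCode, h, stateCode]; rfl⟩

variable (M) in
theorem halts_iff_rewrites (s : Str) : M.Halts s ↔
    ∃ w, Relation.ReflTransGen M.Rewrites (configCode [] 1 [] s) w ∧ CodesFinal w := by
  have h0 : Represents (configCode [] 1 [] s) (M.init s) := ⟨[], [], s, rfl, rfl⟩
  constructor
  · rintro ⟨c, hc, hf⟩
    have : ∃ w, Relation.ReflTransGen M.Rewrites (configCode [] 1 [] s) w ∧ Represents w c := by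
      clear hf
      induction hc with
      | refl => exact ⟨_, .refl, h0⟩
      | tail _ hstep ih =>
        obtain ⟨w, hw, hr⟩ := ih
        obtain ⟨w', hw', hr'⟩ := hr.step hstep
        exact ⟨w', hw.trans hw', hr'⟩
    obtain ⟨w, hw, hr⟩ := this
    exact ⟨w, hw, hr.codesFinal_iff.2 hf⟩
  · rintro ⟨w, hw, hf⟩
    have : ∃ c, Relation.ReflTransGen (fun a b => M.step a = some b) (M.init s) c ∧
        Represents w c := by
      clear hf
      induction hw with
      | refl => exact ⟨_, .refl, h0⟩
      | tail _ hstep ih =>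
        obtain ⟨c, hc, hr⟩ := ih
        obtain ⟨c', hc', hr'⟩ := hr.rewrites hstep
        exact ⟨c', hc.trans hc', hr'⟩
    obtain ⟨c, hc, hr⟩ := this
    exact ⟨c, hc, hr.codesFinal_iff.1 hf⟩

end TuringMachine

/-! ### Formulae with constants for the characters -/

/-- A variable that stands for a character. -/
def charVar : Ch → Var
  | .letter i => ⟨i, [0]⟩
  | .digit i => ⟨0, [1, i]⟩
  | .quote => ⟨0, [2]⟩
  | .backslash => ⟨1, [2]⟩
  | .eq => ⟨2, [2]⟩
  | .ne => ⟨3, [2]⟩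
  | .lpar => ⟨4, [2]⟩
  | .rpar => ⟨5, [2]⟩
  | .tilde => ⟨6, [2]⟩
  | .amp => ⟨7, [2]⟩
  | .bar => ⟨8, [2]⟩
  | .minus => ⟨9, [2]⟩
  | .gt => ⟨10, [2]⟩
  | .bigA => ⟨11, [2]⟩
  | .bigE => ⟨12, [2]⟩
  | .colon => ⟨13, [2]⟩
  | .plus => ⟨14, [2]⟩
  | .star => ⟨15, [2]⟩
  | .lt => ⟨16, [2]⟩

theorem charVar_injective : Function.Injective charVar := by
  intro a b h
  cases a <;> cases b <;> simp_all [charVar]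

def plainVar (i : Fin 26) : Var := ⟨i, []⟩

theorem plainVar_injective : Function.Injective plainVar := fun a b h => by
  simpa [plainVar] using h

theorem charVar_ne_plainVar (c : Ch) (i : Fin 26) : charVar c ≠ plainVar i := by
  cases c <;> simp [charVar, plainVar]

/-- A variable or a constant for a character. -/
abbrev Atom : Type := Fin 26 ⊕ Ch

def Atom.value (e : Fin 26 → Str) : Atom → Str
  | .inl i => e i
  | .inr c => [c]

def Atom.item : Atom → Item
  | .inl i => .var (plainVar i)
  | .inr c => .var (charVar c)

/-- The atoms that spell a string. -/
def spell (s : Str) : List Atom := s.map .inr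

/-- First-order formulae about strings, with constants for the characters; terms may be empty. -/
inductive Schema where
  | eq (t u : List Atom)
  | neg (p : Schema)
  | imp (p q : Schema)
  | all (i : Fin 26) (p : Schema)

namespace Schema

def Holds : Schema → (Fin 26 → Str) → Prop
  | eq t u, e => t.flatMap (Atom.value e) = u.flatMap (Atom.value e)
  | neg p, e => ¬ p.Holds e
  | imp p q, e => p.Holds e → q.Holds e
  | all i p, e => ∀ s, p.Holds (Function.update e i s)

/-- The corresponding formula. Both sides of an equation are preceded by the same variable, so that
their terms are not empty. -/
def toFormula : Schema → Formula
  | eq t u => .eq ⟨.var (charVar .eq) :: t.map Atom.item, by simp⟩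
      ⟨.var (charVar .eq) :: u.map Atom.item, by simp⟩
  | neg p => .neg (.paren p.toFormula)
  | imp p q => .imp (.paren p.toFormula) (.paren q.toFormula)
  | all i p => .all (plainVar i) p.toFormula

theorem toFormula_wellParsed (p : Schema) : p.toFormula.WellParsed := by
  induction p with
  | eq t u => trivial
  | neg p ih => exact ⟨ih, by simp [Formula.RightOperand, Formula.prec]⟩
  | imp p q ihp ihq =>
    exact ⟨ihp, ihq, by simp [Formula.LeftOperand, Formula.prec, Formula.Open],
      by simp [Formula.RightOperand, Formula.prec]⟩
  | all i p ih => exact ih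

theorem toFormula_unambiguous (p : Schema) : p.toFormula.Unambiguous := by
  induction p with
  | eq t u => exact Formula.unambiguous_eq _ _
  | neg p ih => exact ih.neg_paren
  | imp p q ihp ihq => exact ihp.imp_paren ihq
  | all i p ih => exact ih.all _

theorem mem_freeVars_toFormula {p : Schema} {x : Var} (hx : x ∈ p.toFormula.freeVars) :
    (∃ i, x = plainVar i) ∨ ∃ c, x = charVar c := by
  induction p with
  | eq t u =>
    simp only [toFormula, Formula.freeVars, Term.vars, Set.mem_union, Set.mem_ofPred_eq,
      List.mem_cons, List.mem_map, Item.var.injEq] at hx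
    rcases hx with (rfl | ⟨i | c, -, h⟩) | rfl | ⟨i | c, -, h⟩
    all_goals first
      | exact .inr ⟨_, rfl⟩
      | exact .inl ⟨_, (Item.var.inj h).symm⟩
      | exact .inr ⟨_, (Item.var.inj h).symm⟩
  | neg p ih => exact ih hx
  | imp p q ihp ihq => exact hx.elim ihp ihq
  | all i p ih => exact ih hx.1

theorem quote_notMem_varRender (x : Var) : Ch.quote ∉ x.render ∧ Ch.backslash ∉ x.render := by
  simp [Var.render]

theorem quote_notMem_atoms (t : List Atom) :
    Ch.quote ∉ (t.map Atom.item).flatMap Item.render ∧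
      Ch.backslash ∉ (t.map Atom.item).flatMap Item.render := by
  simp only [List.mem_flatMap, List.mem_map, not_exists, not_and]
  constructor <;> rintro _ ⟨i | c, -, rfl⟩
  · exact (quote_notMem_varRender _).1
  · exact (quote_notMem_varRender _).1
  · exact (quote_notMem_varRender _).2
  · exact (quote_notMem_varRender _).2

theorem quote_notMem_render (p : Schema) :
    Ch.quote ∉ p.toFormula.render ∧ Ch.backslash ∉ p.toFormula.render := by
  induction p with
  | eq t u =>
    have h1 := quote_notMem_atoms t
    have h2 := quote_notMem_atoms u
    have h3 := quote_notMem_varRender (charVar .eq)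
    simp only [toFormula, Formula.render, Term.render, List.flatMap_cons, Item.render,
      List.mem_append]
    simp [h1, h2, h3]
  | neg p ih => simp [toFormula, Formula.render, ih]
  | imp p q ihp ihq => simp [toFormula, Formula.render, ihp, ihq]
  | all i p ih => simp [toFormula, Formula.render, ih, quote_notMem_varRender]

/-- This makes quoting harmless in the diagonal sentence: the literal shows the very text of the
formula. -/
theorem encode_render (p : Schema) : encode p.toFormula.render = p.toFormula.render := by
  have h := quote_notMem_render p
  generalize p.toFormula.render = s at h
  induction s with
  | nil => rfl
  | cons c s ih =>
    simp only [List.mem_cons, not_or] at h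
    have ih' := ih ⟨h.1.2, h.2.2⟩
    simp only [encode, List.flatMap_cons] at ih' ⊢
    rw [ih']
    cases c <;> simp_all [encodeChar]

end Schema

/-- Each variable that stands for a character contains it. -/
def Assignment.Spells (v : Assignment) : Prop := ∀ c, v (charVar c) = [c]

theorem Assignment.Spells.update {v : Assignment} (hv : v.Spells) (i : Fin 26) (s : Str) :
    Assignment.Spells (Function.update v (plainVar i) s) := fun c => by
  rw [Function.update_of_ne (charVar_ne_plainVar c i), hv]

theorem Assignment.Spells.atoms_value {v : Assignment} (hv : v.Spells) (t : List Atom) :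
    (t.map Atom.item).flatMap (Item.value v) =
      t.flatMap (Atom.value fun i => v (plainVar i)) := by
  rw [List.flatMap_map]
  congr 1
  ext1 a
  rcases a with i | c
  · rfl
  · exact hv c

/-- Quantifiers of a schema bind plain variables only and so never disturb the character variables;
the common first variable of the two sides of an equation cancels. -/
theorem Schema.holds_toFormula (p : Schema) {v : Assignment} (hv : v.Spells) :
    p.toFormula.Holds v ↔ p.Holds fun i => v (plainVar i) := by
  induction p generalizing v with
  | eq t u =>
    simp only [toFormula, Formula.Holds, Term.value, List.flatMap_cons, hv.atoms_value, Holds,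
      List.append_cancel_left_eq]
  | neg p ih => exact not_congr (ih hv)
  | imp p q ihp ihq => exact imp_congr (ihp hv) (ihq hv)
  | all i p ih =>
    refine forall_congr' fun s => ?_
    rw [ih (hv.update i s)]
    congr! 1
    ext1 j
    by_cases h : j = i
    · subst h; simp
    · rw [Function.update_of_ne h, Function.update_of_ne (plainVar_injective.ne h)]

/-! ### Expressing halting by a schema -/

namespace Schema

def and (p q : Schema) : Schema := neg (imp p (neg q))

def or (p q : Schema) : Schema := imp (neg p) q

def ex (i : Fin 26) (p : Schema) : Schema := neg (all i (neg p))

def anyOf : List Schema → Schema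
  | [] => neg (eq [] [])
  | p :: ps => or p (anyOf ps)

variable {e : Fin 26 → Str}

theorem holds_eq {t u : List Atom} :
    (eq t u).Holds e ↔ t.flatMap (Atom.value e) = u.flatMap (Atom.value e) := Iff.rfl

theorem holds_imp {p q : Schema} : (imp p q).Holds e ↔ (p.Holds e → q.Holds e) := Iff.rfl

theorem holds_all {i : Fin 26} {p : Schema} :
    (all i p).Holds e ↔ ∀ s, p.Holds (Function.update e i s) := Iff.rfl

theorem holds_and {p q : Schema} : (and p q).Holds e ↔ p.Holds e ∧ q.Holds e := by
  simp [and, Holds]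

theorem holds_or {p q : Schema} : (or p q).Holds e ↔ p.Holds e ∨ q.Holds e := by
  simp [or, Holds, or_iff_not_imp_left]

theorem holds_ex {i : Fin 26} {p : Schema} :
    (ex i p).Holds e ↔ ∃ s, p.Holds (Function.update e i s) := by
  simp [ex, Holds]

theorem holds_anyOf {ps : List Schema} : (anyOf ps).Holds e ↔ ∃ p ∈ ps, p.Holds e := by
  induction ps with
  | nil => simp [anyOf, Holds]
  | cons p ps ih => simp [anyOf, holds_or, ih]

theorem flatMap_spell (s : Str) : (spell s).flatMap (Atom.value e) = s := by
  induction s with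
  | nil => rfl
  | cons c s ih => simpa [spell, Atom.value] using ih

/-- The atom `d` does not occur in the variable `u`. -/
def avoids (d : Atom) (u : Fin 26) : Schema :=
  all 24 (all 25 (neg (eq [.inl u] [.inl 24, d, .inl 25])))

theorem holds_avoids_var {d u : Fin 26} (hd : d < 24) (hu : u < 24) :
    (avoids (.inl d) u).Holds e ↔ Avoids (e d) (e u) := by
  have h1 := hd.ne
  have h2 := hu.ne
  have h3 : d ≠ 25 := (hd.trans (by decide)).ne
  have h4 : u ≠ 25 := (hu.trans (by decide)).ne
  simp [avoids, Holds, Atom.value, Avoids, *]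

theorem holds_avoids_char {c : Ch} {u : Fin 26} (hu : u < 24) :
    (avoids (.inr c) u).Holds e ↔ c ∉ e u := by
  have h2 := hu.ne
  have h4 : u ≠ 25 := (hu.trans (by decide)).ne
  simp only [avoids, Holds, Atom.value, Function.update_apply, h2, h4, if_false, if_true,
    List.flatMap_cons, List.flatMap_nil, List.append_nil, List.mem_iff_append, not_exists,
    show (24 : Fin 26) ≠ 25 by decide]
  simp

/-- The production turns the string `x₅` into the string `x₇`. -/
def production (P : Production) : Schema :=
  ex 9 (ex 10 (ex 11 (and (avoids (.inr .plus) 9) (and (avoids (.inr .plus) 10)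
    (and (eq (if P.last then [.inl 11] else []) []) (and
      (eq [.inl 5] (spell (tapeCode P.pop) ++ .inl 9 :: .inr .plus ::
        (spell (stateCode P.source) ++ .inr .plus :: (spell (tapeCode P.read) ++ .inl 10 ::
          .inr .plus :: (spell P.input ++ [.inl 11])))))
      (eq [.inl 7] (spell (tapeCode P.push) ++ .inl 9 :: (spell (tapeCode P.pad) ++ .inr .plus ::
        (spell (stateCode P.target) ++ .inr .plus :: (spell (tapeCode P.write) ++ .inl 10 ::
          (spell (tapeCode P.extend) ++ [.inr .plus, .inl 11]))))))))))))

theorem holds_production (P : Production) :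
    (production P).Holds e ↔ P.Applies (e 5) (e 7) := by
  simp only [production, holds_ex, holds_and, holds_avoids_char (show (9 : Fin 26) < 24 by decide),
    holds_avoids_char (show (10 : Fin 26) < 24 by decide), holds_eq, Production.Applies]
  refine exists_congr fun l => exists_congr fun x => exists_congr fun y => ?_
  have h : ((if P.last then [.inl 11] else [] : List Atom).flatMap
      (Atom.value (Function.update (Function.update (Function.update e 9 l) 10 x) 11 y)) =
      ([] : List Atom).flatMap
      (Atom.value (Function.update (Function.update (Function.update e 9 l) 10 x) 11 y))) ↔
      (P.last = true → y = []) := by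
    cases P.last <;> simp [Atom.value]
  rw [h]
  simp [flatMap_spell, Atom.value]

/-- The string `x₅` is a code of a configuration with the final state. -/
def codesFinal : Schema :=
  ex 9 (ex 10 (and (avoids (.inr .plus) 9)
    (eq [.inl 5] [.inl 9, .inr .plus, .inr .plus, .inl 10])))

theorem holds_codesFinal : codesFinal.Holds e ↔ TuringMachine.CodesFinal (e 5) := by
  simp only [codesFinal, holds_ex, holds_and, holds_eq, TuringMachine.CodesFinal,
    holds_avoids_char (show (9 : Fin 26) < 24 by decide)]
  simp [Atom.value]

/-- The machine halts on the string `x₁`. -/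
def halts (M : TuringMachine) : Schema :=
  ex 2 (ex 3 (ex 12 (and (eq [.inl 12] (spell (configCode [] 1 [] []) ++ [.inl 1]))
    (and (avoids (.inl 2) 12) (and (ex 6 (eq [.inl 3] [.inl 2, .inl 12, .inl 2, .inl 6]))
      (all 4 (all 5 (all 6 (imp (eq [.inl 3] [.inl 4, .inl 2, .inl 5, .inl 2, .inl 6])
        (imp (avoids (.inl 2) 5) (or codesFinal (ex 7 (ex 8
          (and (eq [.inl 6] [.inl 7, .inl 2, .inl 8]) (and (avoids (.inl 2) 7)
            (anyOf (M.productions.map production)))))))))))))))))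

/-- The schema is a transcription of `CodesRun`: variable 2 is the delimiter, 3 the history, 12 the
initial code, 4 to 6 are `p`, `u`, `r`, and 7 and 8 are `u'`, `r'`. -/
theorem holds_halts (M : TuringMachine) : (halts M).Holds e ↔ M.Halts (e 1) := by
  rw [M.halts_iff_rewrites, ← exists_codesRun_iff]
  simp only [halts, holds_ex, holds_all, holds_and, holds_or, holds_imp, holds_eq, holds_anyOf,
    List.mem_map, exists_exists_and_eq_and, holds_production, holds_codesFinal,
    holds_avoids_var (show (2 : Fin 26) < 24 by decide) (show (12 : Fin 26) < 24 by decide),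
    holds_avoids_var (show (2 : Fin 26) < 24 by decide) (show (5 : Fin 26) < 24 by decide),
    holds_avoids_var (show (2 : Fin 26) < 24 by decide) (show (7 : Fin 26) < 24 by decide),
    CodesRun, TuringMachine.Rewrites, List.flatMap_append, flatMap_spell]
  simp [Atom.value, configCode]

end Schema

/-! ### The diagonal sentence -/

theorem Term.value_congr {t : Term} {v w : Assignment}
    (h : ∀ x ∈ t.vars, v x = w x) : t.value v = t.value w := by
  refine List.flatMap_congr fun i hi => ?_
  cases i with
  | var x => exact h x hi
  | lit s => rfl

namespace Formula

/-- The statement of `p` for the case that the variable `x` contains the string `s`. -/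
def bind (x : Var) (s : Str) (p : Formula) : Formula :=
  all x (imp (paren (eq ⟨[.var x], by simp⟩ ⟨[.lit s], by simp⟩)) (paren p))

theorem holds_bind {x : Var} {s : Str} {p : Formula} {v : Assignment} :
    (bind x s p).Holds v ↔ p.Holds (Function.update v x s) := by
  simp [bind, Holds, Term.value, Item.value]

theorem wellParsed_bind {x : Var} {s : Str} {p : Formula} (hp : p.WellParsed) :
    (bind x s p).WellParsed :=
  ⟨trivial, hp, by simp [LeftOperand, prec, Open], by simp [RightOperand, prec]⟩

theorem Unambiguous.bind {p : Formula} (hp : p.Unambiguous) (x : Var) (s : Str) :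
    (bind x s p).Unambiguous :=
  ((unambiguous_eq _ _).imp_paren hp).all x

theorem freeVars_bind (x : Var) (s : Str) (p : Formula) :
    (bind x s p).freeVars = p.freeVars \ {x} := by
  ext y
  simp only [bind, freeVars, Term.vars, List.mem_singleton, Item.var.injEq, reduceCtorEq,
    Set.mem_sdiff, Set.mem_union, Set.mem_ofPred_eq, Set.mem_singleton_iff]
  tauto

theorem render_bind (x : Var) (s : Str) (p : Formula) :
    (bind x s p).render = (Ch.bigA :: (x.render ++ [.colon, .lpar] ++ x.render ++ [.eq, .quote])) ++
      encode s ++ [.quote, .rpar, .minus, .gt, .lpar] ++ p.render ++ [.rpar] := by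
  simp [bind, render, Term.render, Item.render]

/-- The statement of `p` for all values of the plain variables, with the variables for characters
containing these characters. -/
def close (p : Formula) : Formula :=
  (List.finRange 26).foldr (fun i => all (plainVar i))
    (allChars.foldr (fun c => bind (charVar c) [c]) p)

theorem wellParsed_close {p : Formula} (hp : p.WellParsed) : p.close.WellParsed := by
  unfold close
  induction List.finRange 26 with
  | nil =>
    induction allChars with
    | nil => exact hp
    | cons c cs ih => exact wellParsed_bind ih
  | cons i is ih => exact ih

theorem Unambiguous.close {p : Formula} (hp : p.Unambiguous) : p.close.Unambiguous := by
  unfold Formula.close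
  induction List.finRange 26 with
  | nil =>
    induction allChars with
    | nil => exact hp
    | cons c cs ih => exact ih.bind _ _
  | cons i is ih => exact ih.all _

theorem freeVars_close {p : Formula}
    (hp : ∀ x ∈ p.freeVars, (∃ i, x = plainVar i) ∨ ∃ c, x = charVar c) :
    p.close.freeVars = ∅ := by
  have h1 : ∀ (cs : List Ch), ∀ x ∈ (cs.foldr (fun c => bind (charVar c) [c]) p).freeVars,
      x ∈ p.freeVars ∧ ∀ c ∈ cs, x ≠ charVar c := by
    intro cs
    induction cs with
    | nil => simp
    | cons c cs ih =>
      intro x hx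
      rw [List.foldr_cons, freeVars_bind] at hx
      exact ⟨(ih x hx.1).1, List.forall_mem_cons.2 ⟨hx.2, (ih x hx.1).2⟩⟩
  have h2 : ∀ (is : List (Fin 26)) (q : Formula),
      ∀ x ∈ (is.foldr (fun i => all (plainVar i)) q).freeVars,
      x ∈ q.freeVars ∧ ∀ i ∈ is, x ≠ plainVar i := by
    intro is q
    induction is with
    | nil => simp
    | cons i is ih =>
      intro x hx
      exact ⟨(ih x hx.1).1, List.forall_mem_cons.2 ⟨hx.2, (ih x hx.1).2⟩⟩
  refine Set.eq_empty_of_forall_notMem fun x hx => ?_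
  obtain ⟨hx, hi⟩ := h2 _ _ x hx
  obtain ⟨hx, hc⟩ := h1 _ x hx
  rcases hp x hx with ⟨i, rfl⟩ | ⟨c, rfl⟩
  · exact hi i (List.mem_finRange i) rfl
  · exact hc c (mem_allChars c) rfl

/-- The order of the quantifiers matters: the diagonal formula must mention the surrounding text
before it is itself determined. -/
theorem render_close : ∃ pre post : Str, ∀ p : Formula,
    p.close.render = pre ++ p.render ++ post := by
  unfold close
  induction List.finRange 26 with
  | nil =>
    induction allChars with
    | nil => exact ⟨[], [], by simp⟩
    | cons c cs ih =>
      obtain ⟨pre, post, h⟩ := ih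
      obtain ⟨pre', h'⟩ : ∃ pre', ∀ p, (bind (charVar c) [c] p).render =
          pre' ++ p.render ++ [Ch.rpar] := ⟨_, render_bind (charVar c) [c]⟩
      exact ⟨pre' ++ pre, post ++ [Ch.rpar], fun p => by
        simp only [List.foldr_nil] at h
        simp [h', h]⟩
  | cons i is ih =>
    obtain ⟨pre, post, h⟩ := ih
    exact ⟨[Ch.bigA] ++ (plainVar i).render ++ [Ch.colon] ++ pre, post, fun p => by
      simp [render, h]⟩

/-- Whatever `v` is, the bindings overwrite all character variables, so `p` is evaluated at a
spelling assignment. -/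
theorem holds_close {p : Formula} (h : ∀ v : Assignment, v.Spells → p.Holds v) (v : Assignment) :
    p.close.Holds v := by
  have h1 : ∀ (cs : List Ch) (v : Assignment), (∀ c, c ∈ cs ∨ v (charVar c) = [c]) →
      (cs.foldr (fun c => bind (charVar c) [c]) p).Holds v := by
    intro cs
    induction cs with
    | nil => exact fun v hv => h v fun c => (hv c).resolve_left (by simp)
    | cons c cs ih =>
      intro v hv
      refine holds_bind.2 (ih _ fun c' => ?_)
      by_cases hc : c' = c
      · subst hc; simp
      · rw [Function.update_of_ne (charVar_injective.ne hc)]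
        simpa [hc] using hv c'
  unfold close
  induction List.finRange 26 generalizing v with
  | nil => exact h1 _ _ fun c => .inl (mem_allChars c)
  | cons i is ih => exact fun s => ih _

/-- Each quantifier is instantiated with the value that `v` already gives, so `v` is never changed.
-/
theorem holds_of_holds_close {p : Formula} {v : Assignment} (hv : v.Spells)
    (h : p.close.Holds v) : p.Holds v := by
  unfold close at h
  generalize List.finRange 26 = is at h
  induction is with
  | nil =>
    generalize allChars = cs at h
    induction cs with
    | nil => exact h
    | cons c cs ih =>
      have h' := holds_bind.1 h
      rw [← hv c, Function.update_eq_self] at h'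
      exact ih h'
  | cons i is ih =>
    have h' := h (v (plainVar i))
    rw [Function.update_eq_self] at h'
    exact ih h'

theorem update_congr {p : Formula} {x : Var} {v w : Assignment}
    (h : ∀ y ∈ p.freeVars \ {x}, v y = w y) (s : Str) :
    ∀ y ∈ p.freeVars, Function.update v x s y = Function.update w x s y := fun y hy => by
  by_cases hyx : y = x
  · subst hyx; simp
  · simpa [Function.update_of_ne hyx] using h y ⟨hy, hyx⟩

theorem holds_congr {p : Formula} {v w : Assignment} (h : ∀ x ∈ p.freeVars, v x = w x) :
    p.Holds v ↔ p.Holds w := by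
  induction p generalizing v w with
  | eq t u =>
    rw [Holds, Holds, t.value_congr fun x hx => h x (.inl hx),
      u.value_congr fun x hx => h x (.inr hx)]
  | ne t u =>
    rw [Holds, Holds, t.value_congr fun x hx => h x (.inl hx),
      u.value_congr fun x hx => h x (.inr hx)]
  | paren p ih => exact ih h
  | neg p ih => exact not_congr (ih h)
  | and p q ihp ihq =>
    exact and_congr (ihp fun x hx => h x (.inl hx)) (ihq fun x hx => h x (.inr hx))
  | or p q ihp ihq =>
    exact or_congr (ihp fun x hx => h x (.inl hx)) (ihq fun x hx => h x (.inr hx))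
  | imp p q ihp ihq =>
    exact imp_congr (ihp fun x hx => h x (.inl hx)) (ihq fun x hx => h x (.inr hx))
  | all x p ih => exact forall_congr' fun s => ih (update_congr h s)
  | ex x p ih => exact exists_congr fun s => ih (update_congr h s)

end Formula

/-- The machine does not halt on the sentence that results from inserting the string `x₀` twice
between the given strings. -/
def nonhalting (M : TuringMachine) (pre mid post : Str) : Schema :=
  .all 1 (.imp (.eq [.inl 1] (spell pre ++ .inl 0 :: (spell mid ++ .inl 0 :: spell post)))
    (.neg (.halts M)))

theorem holds_nonhalting {M : TuringMachine} {pre mid post : Str} {e : Fin 26 → Str} :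
    (nonhalting M pre mid post).Holds e ↔ ¬ M.Halts (pre ++ e 0 ++ mid ++ e 0 ++ post) := by
  simp [nonhalting, Schema.Holds, Schema.holds_halts, Schema.flatMap_spell, Atom.value]

theorem exists_spells : ∃ v : Assignment, v.Spells :=
  have : Nonempty Ch := ⟨.plus⟩
  ⟨fun x => [Function.invFun charVar x], fun c => by
    simp only [Function.leftInverse_invFun charVar_injective c]⟩

/-- For each machine there is a sentence that claims that the machine does not halt on it. -/
theorem exists_diagonal (M : TuringMachine) : ∃ g : Formula, g.WellParsed ∧ g.Unambiguous ∧
    g.freeVars = ∅ ∧ (¬ M.Halts g.render → ∀ v, g.Holds v) ∧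
      ((∀ v, g.Holds v) → ¬ M.Halts g.render) := by
  obtain ⟨pre, post, hr⟩ := Formula.render_close
  let x := plainVar 0
  let mid : Str := [.quote, .rpar, .minus, .gt, .lpar]
  let pre' : Str := pre ++ Ch.bigA :: (x.render ++ [.colon, .lpar] ++ x.render ++ [.eq, .quote])
  -- The three constants are exactly the text of `g` around its two copies of `s`, so variable 0
  -- with value `s` makes `ψ` speak of the string of `g`.
  let ψ := nonhalting M pre' mid (Ch.rpar :: post)
  let s := ψ.toFormula.render
  let g := (Formula.bind x s ψ.toFormula).close
  have hg : g.render = pre' ++ s ++ mid ++ s ++ (Ch.rpar :: post) := by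
    have : encode s = s := ψ.encode_render
    simp [g, hr, Formula.render_bind, this, pre', mid, s]
  have hψ : ∀ v : Assignment, v.Spells →
      ((Formula.bind x s ψ.toFormula).Holds v ↔ ¬ M.Halts g.render) := by
    intro v hv
    rw [Formula.holds_bind, ψ.holds_toFormula (hv.update 0 s), holds_nonhalting, hg]
    simp
  refine ⟨g, Formula.wellParsed_close (Formula.wellParsed_bind ψ.toFormula_wellParsed),
    (ψ.toFormula_unambiguous.bind x s).close, Formula.freeVars_close fun y hy => ?_,
    fun h => Formula.holds_close fun v hv => (hψ v hv).2 h, fun h => ?_⟩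
  · rw [Formula.freeVars_bind] at hy
    exact Schema.mem_freeVars_toFormula hy.1
  · obtain ⟨v, hv⟩ := exists_spells
    exact (hψ v hv).1 (Formula.holds_of_holds_close hv (h v))

/-! ### The contradiction, and bivalence of sentences -/

theorem not_recursivelyEnumerable_trueSentences :
    ¬ RecursivelyEnumerable {s : Str | IsTrueSentence s} := by
  rintro ⟨M, hM⟩
  obtain ⟨g, hwp, hu, hfree, h1, h2⟩ := exists_diagonal M
  have hnot : ¬ M.Halts g.render := fun h => by
    obtain ⟨p, hp, -, hv⟩ := (hM _).1 h
    -- Truth is asserted of some reading of the string; unambiguity identifies it with `g`.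
    obtain rfl := hu.readsAs_eq hp
    exact h2 hv h
  exact hnot ((hM _).2 ⟨g, ⟨hwp, rfl⟩, hfree, h1 hnot⟩)

theorem IsSentence.true_or_false {s : Str} (h : IsSentence s) :
    IsTrueSentence s ∨ IsFalseSentence s := by
  obtain ⟨p, hp, hfree⟩ := h
  have key : ∀ v w, p.Holds v ↔ p.Holds w := fun v w =>
    Formula.holds_congr (by simp [hfree])
  by_cases h : p.Holds fun _ => []
  · exact .inl ⟨p, hp, hfree, fun v => (key _ v).1 h⟩
  · exact .inr ⟨p, hp, hfree, fun v hv => h ((key v _).1 hv)⟩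

end StringTheory

theorem theorem1 :
    (∀ P : StringTheory.ProofSystem,
      (∃ s : StringTheory.Str, StringTheory.IsFalseSentence s ∧ P.Proves s) ∨
      (∃ s : StringTheory.Str, StringTheory.IsTrueSentence s ∧ ¬ P.Proves s)) ∧
    ¬ StringTheory.RecursivelyEnumerable {s : StringTheory.Str | StringTheory.IsTrueSentence s} := by
  refine ⟨fun P => ?_, StringTheory.not_recursivelyEnumerable_trueSentences⟩
  by_contra! hP
  refine StringTheory.not_recursivelyEnumerable_trueSentences ⟨P.machine, fun s => ⟨fun h => ?_,
    fun h => (hP.2 s h).2⟩⟩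
  have hs : StringTheory.IsSentence s := by
    by_contra hs
    exact P.not_halts s hs h
  exact hs.true_or_false.resolve_right fun hf => hP.1 s hf ⟨hs, h⟩
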